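/- Let $\alpha(t)=\sum_{n\ge 0}\alpha_n t^n$ have real coefficients with $\sum_n|\alpha_n|<\infty$, and suppose that $\alpha$ has no zeros in the open unit disc $\mathbb D\subset\mathbb C$. Put $k(t)=1/\alpha(t)=\sum_{n\ge 0}k_n t^n$ for $t\in\mathbb D$, and suppose that $\alpha_0=k_0=1$ and $k_n>0$ for all $n\ge 1$. For a complex Hilbert space $\mathfrak D$, let $\mathcal H_k\otimes\mathfrak D$ be the Hilbert space of power series $f(t)=\sum_{n\ge 0}f_nt^n$ with coefficients $f_n\in\mathfrak D$ and $\|f\|^2=\sum_n\|f_n\|^2k_n<\infty$, and let $B_k\otimes I_{\mathfrak D}$ be the backward shift $f(t)\mapsto (f(t)-f(0))/t$ on it. Let $\mathcal R_k$ be the Hilbert space of power series $f(z)=\sum_{n\ge 0}f_nz^n$ with $f_n\in\mathbb C$ and $\|f\|^2=\sum_n|f_n|^2/k_n<\infty$. Assume that $\mathcal R_k$ is a Banach algebra with respect to the multiplication of power series, that is, $fg\in\mathcal R_k$ and $\|fg\|\le C\|f\|\,\|g\|$ for all $f,g\in\mathcal R_k$, with a constant $C$ (so that, in particular, $B_k\otimes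 I_{\mathfrak D}$ is bounded). Assume also that $$\lim_{n\to\infty}\Big(\inf_{j\ge 0}\frac{k_j}{k_{n+j}}\Big)^{1/n}=\lim_{n\to\infty}k_n^{1/n}=1 .$$ **Theorem.** Let $\mathfrak D$ be finite dimensional and let $T$ be a bounded operator on a complex Hilbert space $H$ that is similar to a part of $B_k\otimes I_{\mathfrak D}$: there are a closed subspace $L\subset\mathcal H_k\otimes\mathfrak D$, invariant under $B_k\otimes I_{\mathfrak D}$, and a bounded invertible operator $S:H\to L$ with $ST=\big((B_k\otimes I_{\mathfrak D})|_L\big)S$. If the spectrum $\sigma(T)$ does not contain $\mathbb D$, then there is a non-zero function $f\in\mathcal R_k$ such that $f(z)=0$ for every $z\in\sigma(T)\cap\mathbb D$. -/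

import Mathlib

open Filter Topology

/-- Positive weights `w 0, w 1, w 2, …`. -/
abbrev PosWeight : Type := ℕ → {x : ℝ // 0 < x}

/-- The coefficient sequences `f₀, f₁, …` in `E` with `∑ ‖fₙ‖² wₙ < ∞`. -/
def weightedSubmodule (w : PosWeight) (E : Type*) [NormedAddCommGroup E]
    [InnerProductSpace ℂ E] : Submodule ℂ (ℕ → E) where
  carrier := {f | Summable fun n => ‖f n‖ ^ 2 * (w n : ℝ)}
  zero_mem' := by simp [summable_zero]
  add_mem' := by
    intro f g hf hg
    refine Summable.of_nonneg_of_le (fun n => mul_nonneg (sq_nonneg _) (w n).2.le) (fun n => ?_)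
      ((Summable.add hf hg).mul_left 2)
    have h1 : ‖f n + g n‖ ^ 2 ≤ 2 * (‖f n‖ ^ 2 + ‖g n‖ ^ 2) := by
      have := norm_add_le (f n) (g n)
      nlinarith [sq_nonneg (‖f n‖ - ‖g n‖), norm_nonneg (f n + g n)]
    have := mul_le_mul_of_nonneg_right h1 (w n).2.le
    simp only [Pi.add_apply]
    linarith
  smul_mem' := by
    intro c f hf
    have := Summable.mul_left (‖c‖ ^ 2) hf
    refine this.congr (fun n => ?_)
    simp only [Pi.smul_apply, norm_smul]
    ring

/-- The weighted Hilbert space of `E`-valued power series `f(t) = ∑ fₙ tⁿ` with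
`‖f‖² = ∑ ‖fₙ‖² wₙ < ∞`, a series being given by its coefficients. For `E = ℂ` this is `ℋ_w`; in
general it is the standard realization of the Hilbert space tensor product `ℋ_w ⊗ E`. -/
def WeightedSeries (w : PosWeight) (E : Type*) [NormedAddCommGroup E]
    [InnerProductSpace ℂ E] : Type _ :=
  weightedSubmodule w E

namespace WeightedSeries

variable {w : PosWeight} {E : Type*} [NormedAddCommGroup E] [InnerProductSpace ℂ E]

instance instAddCommGroup : AddCommGroup (WeightedSeries w E) :=
  inferInstanceAs (AddCommGroup (weightedSubmodule w E))

instance instModule : Module ℂ (WeightedSeries w E) :=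
  inferInstanceAs (Module ℂ (weightedSubmodule w E))

/-- `f n` is the `n`-th coefficient of the power series `f`. -/
instance instCoeFun : CoeFun (WeightedSeries w E) (fun _ => ℕ → E) :=
  ⟨fun f => Subtype.val f⟩

theorem ext {f g : WeightedSeries w E} (h : ∀ n, f n = g n) : f = g :=
  Subtype.ext (funext h)

theorem summable (f : WeightedSeries w E) : Summable fun n => ‖f n‖ ^ 2 * (w n : ℝ) := f.2

/-- The power series with a given sequence of coefficients. -/
def mk (f : ℕ → E) (hf : Summable fun n => ‖f n‖ ^ 2 * (w n : ℝ)) : WeightedSeries w E :=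
  ⟨f, hf⟩

theorem summable_inner (f g : WeightedSeries w E) :
    Summable fun n => ((w n : ℝ) : ℂ) * inner ℂ (f n) (g n) := by
  refine Summable.of_norm_bounded (f.summable.add g.summable) (fun n => ?_)
  have h0 := (w n).2
  rw [norm_mul, Complex.norm_real, Real.norm_eq_abs, abs_of_pos h0]
  have h1 := norm_inner_le_norm (𝕜 := ℂ) (f n) (g n)
  have h2 : ‖inner ℂ (f n) (g n)‖ ≤ ‖f n‖ ^ 2 + ‖g n‖ ^ 2 := by
    nlinarith [sq_nonneg (‖f n‖ - ‖g n‖), sq_nonneg (‖f n‖), sq_nonneg (‖g n‖)]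
  nlinarith

theorem inner_self_term (f : WeightedSeries w E) (n : ℕ) :
    ((w n : ℝ) : ℂ) * inner ℂ (f n) (f n) = ((‖f n‖ ^ 2 * (w n : ℝ) : ℝ) : ℂ) := by
  rw [inner_self_eq_norm_sq_to_K]
  push_cast
  exact mul_comm _ _

/-- The inner product `⟨f, g⟩ = ∑ wₙ ⟨fₙ, gₙ⟩`, antilinear in the first argument. -/
noncomputable abbrev core : InnerProductSpace.Core ℂ (WeightedSeries w E) where
  inner f g := ∑' n, ((w n : ℝ) : ℂ) * inner ℂ (f n) (g n)
  conj_inner_symm f g := by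
    rw [Complex.conj_tsum]
    refine tsum_congr (fun n => ?_)
    rw [map_mul, Complex.conj_ofReal, inner_conj_symm]
  re_inner_nonneg f := by
    simp only [inner_self_term]
    rw [← Complex.ofReal_tsum]
    exact tsum_nonneg (fun n => mul_nonneg (sq_nonneg _) (w n).2.le)
  add_left f g h := by
    rw [← (summable_inner f h).tsum_add (summable_inner g h)]
    refine tsum_congr (fun n => ?_)
    rw [← mul_add, ← inner_add_left]
    rfl
  smul_left f g c := by
    rw [← tsum_mul_left]
    refine tsum_congr (fun n => ?_)
    rw [mul_left_comm, ← inner_smul_left]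
    rfl
  definite f hf := by
    simp only [inner_self_term] at hf
    rw [← Complex.ofReal_tsum, Complex.ofReal_eq_zero] at hf
    have h1 := (hasSum_zero_iff_of_nonneg
      (fun n => mul_nonneg (sq_nonneg ‖f n‖) (w n).2.le)).1 (hf ▸ f.summable.hasSum)
    refine ext (fun n => ?_)
    have h2 : f n = 0 := by simpa [(w n).2.ne'] using congrFun h1 n
    exact h2

noncomputable instance instNormedAddCommGroup : NormedAddCommGroup (WeightedSeries w E) :=
  core.toNormedAddCommGroup

noncomputable instance instInnerProductSpace : InnerProductSpace ℂ (WeightedSeries w E) :=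
  InnerProductSpace.ofCore core.toCore

theorem norm_sq_eq (f : WeightedSeries w E) : ‖f‖ ^ 2 = ∑' n, ‖f n‖ ^ 2 * (w n : ℝ) := by
  have h : inner ℂ f f = ∑' n, ((w n : ℝ) : ℂ) * inner ℂ (f n) (f n) := rfl
  simp only [inner_self_term] at h
  rw [inner_self_eq_norm_sq_to_K, ← Complex.ofReal_tsum] at h
  exact Complex.ofReal_injective (by simpa using h)

end WeightedSeries

/-- The backward shift `f(t) ↦ (f(t) - f(0)) / t` on the space of `E`-valued power series with
weights `w`, that is, the operator `B_w ⊗ I_E`. It is a bounded operator as soon as the quotients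
`wₙ / wₙ₊₁` are bounded. -/
noncomputable def backwardShift (w : PosWeight) (E : Type*) [NormedAddCommGroup E]
    [InnerProductSpace ℂ E] (hw : ∃ C : ℝ, ∀ n, (w n : ℝ) ≤ C * (w (n + 1) : ℝ)) :
    WeightedSeries w E →L[ℂ] WeightedSeries w E :=
  have hsum : ∀ f : WeightedSeries w E,
      Summable fun n => ‖f (n + 1)‖ ^ 2 * (w n : ℝ) := fun f => by
    obtain ⟨C, hC⟩ := hw
    refine Summable.of_nonneg_of_le (fun n => mul_nonneg (sq_nonneg _) (w n).2.le) (fun n => ?_)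
      (((summable_nat_add_iff 1).2 f.summable).mul_left C)
    have := mul_le_mul_of_nonneg_left (hC n) (sq_nonneg ‖f (n + 1)‖)
    linarith
  LinearMap.mkContinuousOfExistsBound
    { toFun := fun f => WeightedSeries.mk (fun n => f (n + 1)) (hsum f)
      map_add' := fun _ _ => rfl
      map_smul' := fun _ _ => rfl }
    (by
      obtain ⟨C, hC⟩ := hw
      have hC0 : 0 ≤ C := by
        by_contra h
        have h1 := hC 0
        have h2 := (w 0).2
        have h3 := (w (0 + 1)).2
        nlinarith
      refine ⟨√C, fun f => ?_⟩
      refine le_of_sq_le_sq ?_ (by positivity)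
      rw [mul_pow, Real.sq_sqrt hC0, WeightedSeries.norm_sq_eq, WeightedSeries.norm_sq_eq,
        f.summable.tsum_eq_zero_add, mul_add, ← tsum_mul_left]
      have h1 : ∑' n, ‖f (n + 1)‖ ^ 2 * (w n : ℝ)
          ≤ ∑' n, C * (‖f (n + 1)‖ ^ 2 * (w (n + 1) : ℝ)) := by
        refine Summable.tsum_le_tsum (fun n => ?_) (hsum f)
          (((summable_nat_add_iff 1).2 f.summable).mul_left C)
        have := mul_le_mul_of_nonneg_left (hC n) (sq_nonneg ‖f (n + 1)‖)
        linarith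
      have h2 : 0 ≤ C * (‖f 0‖ ^ 2 * (w 0 : ℝ)) :=
        mul_nonneg hC0 (mul_nonneg (sq_nonneg _) (w 0).2.le)
      exact h1.trans (by linarith))

theorem backwardShift_apply (w : PosWeight) (E : Type*) [NormedAddCommGroup E]
    [InnerProductSpace ℂ E] (hw : ∃ C : ℝ, ∀ n, (w n : ℝ) ≤ C * (w (n + 1) : ℝ))
    (f : WeightedSeries w E) (n : ℕ) : backwardShift w E hw f n = f (n + 1) := rfl

/-- The space `ℛ_k`: the scalar power series with weights `1 / kₙ`. -/
abbrev RSpace (k : PosWeight) : Type := WeightedSeries (fun n => (k n)⁻¹) ℂ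

/-- `ℛ_k` is a Banach algebra for the multiplication of power series: the (Cauchy) product of two
elements is again an element, and the product is bounded. -/
def RSpace.IsBanachAlgebra (k : PosWeight) : Prop :=
  ∃ C : ℝ, ∀ f g : RSpace k, ∃ h : RSpace k,
    (∀ n, h n = ∑ p ∈ Finset.HasAntidiagonal.antidiagonal n, f p.1 * g p.2) ∧ ‖h‖ ≤ C * ‖f‖ * ‖g‖

/-- The zero set, in the open unit disc, of the function `z ↦ ∑ fₙ zⁿ`. -/
def RSpace.zeroSet {k : PosWeight} (f : RSpace k) : Set ℂ :=
  {z | ‖z‖ < 1 ∧ HasSum (fun n => f n * z ^ n) 0}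

theorem RSpace.norm_sq_single {k : PosWeight} (f : RSpace k) (m : ℕ) (hm : f m = 1)
    (h : ∀ n, n ≠ m → f n = 0) : ‖f‖ ^ 2 = (k m : ℝ)⁻¹ := by
  rw [WeightedSeries.norm_sq_eq, tsum_eq_single m]
  · simp [hm]
  · intro n hn
    simp [h n hn]

/-- If `ℛ_k` is a Banach algebra, then multiplication by `z` is bounded on it, which means that the
quotients `kₙ / kₙ₊₁` are bounded. -/
theorem RSpace.IsBanachAlgebra.exists_bound {k : PosWeight} (hk : RSpace.IsBanachAlgebra k) :
    ∃ C : ℝ, ∀ n, (k n : ℝ) ≤ C * (k (n + 1) : ℝ) := by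
  obtain ⟨C, hC⟩ := hk
  have hs : ∀ m : ℕ, Summable fun n =>
      ‖(Pi.single m (1 : ℂ) : ℕ → ℂ) n‖ ^ 2 * (((k n)⁻¹ : {x : ℝ // 0 < x}) : ℝ) := fun m =>
    summable_of_ne_finset_zero (s := {m}) (fun n hn => by
      have : n ≠ m := by simpa using hn
      simp [this])
  let e : ℕ → RSpace k := fun m => WeightedSeries.mk (Pi.single m (1 : ℂ)) (hs m)
  have he : ∀ m n, e m n = (Pi.single m (1 : ℂ) : ℕ → ℂ) n := fun _ _ => rfl
  have hn : ∀ m, ‖e m‖ ^ 2 = (k m : ℝ)⁻¹ := fun m =>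
    RSpace.norm_sq_single (e m) m (by simp [he]) (fun n h => by simp [he, h])
  refine ⟨C ^ 2 * (k 1 : ℝ)⁻¹, fun m => ?_⟩
  obtain ⟨h, hh, hle⟩ := hC (e 1) (e m)
  have hcoef : ∀ n, h n = if n = m + 1 then 1 else 0 := by
    intro n
    rw [hh]
    by_cases hnm : n = m + 1
    · rw [if_pos hnm, Finset.sum_eq_single (1, m)]
      · simp [he]
      · rintro ⟨a, b⟩ _ hab
        by_cases ha : a = 1
        · have hb : b ≠ m := fun hb => hab (by rw [ha, hb])
          simp [he, hb]
        · simp [he, ha]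
      · intro hmem
        exact absurd (Finset.HasAntidiagonal.mem_antidiagonal.2 (by omega)) hmem
    · rw [if_neg hnm]
      refine Finset.sum_eq_zero ?_
      rintro ⟨a, b⟩ hab
      have hab' := Finset.HasAntidiagonal.mem_antidiagonal.1 hab
      by_cases ha : a = 1
      · have hb : b ≠ m := fun hb => hnm (by simp only at hab'; omega)
        simp [he, hb]
      · simp [he, ha]
  have h1 : ‖h‖ ^ 2 = (k (m + 1) : ℝ)⁻¹ :=
    RSpace.norm_sq_single h (m + 1) (by simp [hcoef]) (fun n hne => by simp [hcoef, hne])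
  have h2 : ‖h‖ ^ 2 ≤ (C * ‖e 1‖ * ‖e m‖) ^ 2 := pow_le_pow_left₀ (norm_nonneg _) hle 2
  rw [mul_pow, mul_pow, hn, hn, h1] at h2
  have p1 := (k m).2
  have p2 := (k (m + 1)).2
  have h3 := mul_le_mul_of_nonneg_right h2 (mul_pos p1 p2).le
  have e1 : (k (m + 1) : ℝ)⁻¹ * ((k m : ℝ) * (k (m + 1) : ℝ)) = (k m : ℝ) := by
    field_simp
  have e2 : C ^ 2 * (k 1 : ℝ)⁻¹ * (k m : ℝ)⁻¹ * ((k m : ℝ) * (k (m + 1) : ℝ))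
      = C ^ 2 * (k 1 : ℝ)⁻¹ * (k (m + 1) : ℝ) := by
    rw [mul_assoc (C ^ 2 * (k 1 : ℝ)⁻¹), inv_mul_cancel_left₀ p1.ne']
  rwa [e1, e2] at h3

/-- The standing assumptions on `α(t) = ∑ αₙ tⁿ` and `k(t) = ∑ kₙ tⁿ` (where `kₙ > 0`): the real
sequence `αₙ` is summable, `α` has no zeros in the open unit disc, `α₀ = k₀ = 1` and
`k(t) = 1 / α(t)` in the open unit disc. -/
structure IsReciprocalPair (α : ℕ → ℝ) (k : PosWeight) : Prop where
  summable_abs : Summable fun n => |α n|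
  ne_zero : ∀ t : ℂ, ‖t‖ < 1 → ∑' n, (α n : ℂ) * t ^ n ≠ 0
  alpha_zero : α 0 = 1
  k_zero : (k 0 : ℝ) = 1
  hasSum_k : ∀ t : ℂ, ‖t‖ < 1 →
    HasSum (fun n => ((k n : ℝ) : ℂ) * t ^ n) (1 / ∑' n, (α n : ℂ) * t ^ n)

/-- `T` is similar to a part of `A`, that is, to the restriction of `A` to a closed invariant
subspace `L`; the similarity is a bounded invertible operator from `H` onto `L`. -/
def IsSimilarToPart {H K : Type*} [NormedAddCommGroup H] [InnerProductSpace ℂ H]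
    [NormedAddCommGroup K] [InnerProductSpace ℂ K] (T : H →L[ℂ] H) (A : K →L[ℂ] K) : Prop :=
  ∃ L : Submodule ℂ K, IsClosed (L : Set K) ∧ (∀ x ∈ L, A x ∈ L) ∧
    ∃ S : H ≃L[ℂ] L, ∀ x : H, (S (T x) : K) = A (S x)

/-!
An element `f` of `ℛ_k` acts on `ℋ_k ⊗ D` as `∑ fₙ Bⁿ`, where `B` is the backward shift. If `|x|`
is the series of the norms of the coefficients of `x`, then `|⟨y, Bⁿ x⟩| ≤ ⟨|y|, Bⁿ |x|⟩`, and
`∑ |fₙ| ⟨|y|, Bⁿ |x|⟩` is the pairing of `|x|` with a product in the algebra `ℛ_k`, which bounds the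
partial sums of `∑ fₙ Bⁿ`. In this pairing, `B` is the transpose of the multiplication by the
variable, so that the functionals annihilating an invariant subspace `L`, written as rows of `dim D`
elements of `ℛ_k`, form an `ℛ_k`-module. Let `M` be the matrix whose rows represent the projections
onto `Lᗮ` of the eigenvectors `∑ zⁿ bᵢ tⁿ`, where the `bᵢ` are an orthonormal basis of `D`. By
Cramer's rule, `f = det M` multiplies every row into that module, which means that `∑ fₙ Bⁿ`
vanishes on `L`. The value of `f` at `z` is the Gram determinant of these projections, which is
nonzero when `z` is not an eigenvalue of the restriction of `B` to `L`. Thus `f ≠ 0` and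
`∑ fₙ Tⁿ = 0`, and spectral mapping shows that `f` vanishes on the spectrum of `T`.
-/

namespace WeightedSeries

variable {w : PosWeight} {E : Type*} [NormedAddCommGroup E] [InnerProductSpace ℂ E]

theorem sum_apply {ι : Type*} (s : Finset ι) (f : ι → WeightedSeries w E) (n : ℕ) :
    (∑ i ∈ s, f i) n = ∑ i ∈ s, f i n :=
  (congrFun (map_sum (weightedSubmodule w E).subtype f s) n).trans (Finset.sum_apply n s _)

/-- The monomial `e tⁿ`. -/
noncomputable def single (n : ℕ) (e : E) : WeightedSeries w E :=
  mk (Pi.single n e) <| summable_of_ne_finset_zero (s := {n}) fun m hm => by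
    simp [Pi.single_eq_of_ne (Finset.notMem_singleton.1 hm)]

theorem sum_single_apply (s : Finset ℕ) (f : ℕ → E) (m : ℕ) :
    (∑ n ∈ s, single n (f n) : WeightedSeries w E) m = if m ∈ s then f m else 0 := by
  rw [sum_apply]
  exact Finset.sum_pi_single m f s

theorem norm_sub_sum_single_sq (f : WeightedSeries w E) (s : Finset ℕ) :
    ‖∑ n ∈ s, single n (f n) - f‖ ^ 2 = ∑' n : {n // n ∉ s}, ‖f n‖ ^ 2 * (w n : ℝ) := by
  refine (norm_sq_eq _).trans <| .trans (tsum_congr fun n => ?_)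
    (tsum_subtype {n | n ∉ s} fun n => ‖f n‖ ^ 2 * (w n : ℝ)).symm
  have h : (∑ n ∈ s, single n (f n) - f : WeightedSeries w E) n =
      (if n ∈ s then f n else 0) - f n :=
    congrArg (· - f n) (sum_single_apply s f n)
  by_cases hn : n ∈ s <;> simp [h, hn]

theorem hasSum_single (f : WeightedSeries w E) : HasSum (fun n => single n (f n)) f := by
  have h : Tendsto (fun s : Finset ℕ => ‖∑ n ∈ s, single n (f n) - f‖ ^ 2) atTop (𝓝 0) := by
    simpa only [norm_sub_sum_single_sq] using
      tendsto_tsum_compl_atTop_zero fun n => ‖f n‖ ^ 2 * (w n : ℝ)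
  have hnorm : Tendsto (fun s : Finset ℕ => ‖∑ n ∈ s, single n (f n) - f‖) atTop (𝓝 0) := by
    simpa only [Real.sqrt_sq (norm_nonneg _), Real.sqrt_zero] using h.sqrt
  exact tendsto_iff_norm_sub_tendsto_zero.2 hnorm

/-- The series of the norms of the coefficients. -/
noncomputable def abs (x : WeightedSeries w E) : WeightedSeries w ℂ :=
  mk (fun n => (‖x n‖ : ℂ)) <| by simpa using x.summable

theorem abs_apply (x : WeightedSeries w E) (n : ℕ) : x.abs n = (‖x n‖ : ℂ) := rfl

theorem norm_abs (x : WeightedSeries w E) : ‖x.abs‖ = ‖x‖ := by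
  refine (sq_eq_sq₀ (norm_nonneg _) (norm_nonneg _)).1 ?_
  simp [norm_sq_eq, abs_apply]

theorem hasSum_inner (x y : WeightedSeries w E) :
    HasSum (fun n => ((w n : ℝ) : ℂ) * inner ℂ (x n) (y n)) (inner ℂ x y) :=
  (summable_inner x y).hasSum

theorem norm_inner_le_re_inner_abs (x y : WeightedSeries w E) :
    ‖inner ℂ x y‖ ≤ (inner ℂ x.abs y.abs : ℂ).re := by
  have hre := Complex.hasSum_re (hasSum_inner x.abs y.abs)
  rw [← (hasSum_inner x y).tsum_eq]
  refine tsum_of_norm_bounded hre fun n => ?_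
  calc ‖((w n : ℝ) : ℂ) * inner ℂ (x n) (y n)‖
      ≤ (w n : ℝ) * (‖x n‖ * ‖y n‖) := by
        rw [norm_mul, Complex.norm_real, Real.norm_of_nonneg (w n).2.le]
        exact mul_le_mul_of_nonneg_left (norm_inner_le_norm _ _) (w n).2.le
    _ = (((w n : ℝ) : ℂ) * inner ℂ (x.abs n) (y.abs n)).re := by
        simp [abs_apply, mul_comm]

/-- The scalar series with coefficients `⟨e, xₙ⟩`. -/
noncomputable def coord (e : E) (x : WeightedSeries w E) : WeightedSeries w ℂ :=
  mk (fun n => inner ℂ e (x n)) <| by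
    refine Summable.of_nonneg_of_le (fun n => mul_nonneg (sq_nonneg _) (w n).2.le) (fun n => ?_)
      (x.summable.mul_left (‖e‖ ^ 2))
    rw [← mul_assoc, ← mul_pow]
    exact mul_le_mul_of_nonneg_right
      (pow_le_pow_left₀ (norm_nonneg _) (norm_inner_le_norm _ _) 2) (w n).2.le

theorem coord_apply (e : E) (x : WeightedSeries w E) (n : ℕ) :
    coord e x n = inner ℂ e (x n) := rfl

theorem sum_inner_coord {ι : Type*} [Fintype ι] (b : OrthonormalBasis ι ℂ E)
    (x y : WeightedSeries w E) :
    ∑ i, inner ℂ (coord (b i) x) (coord (b i) y) = (inner ℂ x y : ℂ) := by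
  refine (hasSum_sum fun i _ => hasSum_inner (coord (b i) x) (coord (b i) y)).unique ?_
  convert! hasSum_inner x y using 2 with n
  rw [← Finset.mul_sum, ← b.sum_inner_mul_inner]
  simp [coord_apply, mul_comm]

variable {hw : ∃ C : ℝ, ∀ n, (w n : ℝ) ≤ C * (w (n + 1) : ℝ)}

theorem backwardShift_pow_apply (n : ℕ) (x : WeightedSeries w E) (m : ℕ) :
    (backwardShift w E hw ^ n) x m = x (m + n) := by
  induction n generalizing x with
  | zero => rfl
  | succ n ih => rw [pow_succ, mul_apply_eq_comp, ih, backwardShift_apply, add_assoc]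

theorem abs_backwardShift_pow (n : ℕ) (x : WeightedSeries w E) :
    ((backwardShift w E hw ^ n) x).abs = (backwardShift w ℂ hw ^ n) x.abs :=
  ext fun m => by simp only [abs_apply, backwardShift_pow_apply]

theorem coord_backwardShift_pow (e : E) (n : ℕ) (x : WeightedSeries w E) :
    coord e ((backwardShift w E hw ^ n) x) = (backwardShift w ℂ hw ^ n) (coord e x) :=
  ext fun m => by simp only [coord_apply, backwardShift_pow_apply]

end WeightedSeries

namespace RSpace

open WeightedSeries

variable {k : PosWeight}

/-- The conjugate-linear isometry `y ↦ ∑ kₙ ȳₙ zⁿ` of `ℋ_k` onto `ℛ_k`. Through it the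
coefficientwise pairing of the two spaces is the inner product of `ℋ_k`. -/
noncomputable def riesz : WeightedSeries k ℂ ≃ₗᵢ⋆[ℂ] RSpace k where
  toFun y := mk (fun n => (k n : ℝ) * star (y n)) <| y.summable.congr fun n => by
    have := (k n).2.ne'
    simp only [norm_mul, norm_star, Complex.norm_real, Real.norm_of_nonneg (k n).2.le,
      Positive.coe_inv]
    field_simp
  invFun f := mk (fun n => star (f n) / (k n : ℝ)) <| f.summable.congr fun n => by
    have := (k n).2.ne'
    simp only [norm_div, norm_star, Complex.norm_real, Real.norm_of_nonneg (k n).2.le,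
      Positive.coe_inv]
    field_simp
  left_inv y := ext fun n => by
    have : ((k n : ℝ) : ℂ) ≠ 0 := Complex.ofReal_ne_zero.2 (k n).2.ne'
    change star ((k n : ℝ) * star (y n)) / ((k n : ℝ) : ℂ) = y n
    simp [mul_div_cancel_left₀, this]
  right_inv f := ext fun n => by
    have : ((k n : ℝ) : ℂ) ≠ 0 := Complex.ofReal_ne_zero.2 (k n).2.ne'
    change ((k n : ℝ) : ℂ) * star (star (f n) / ((k n : ℝ) : ℂ)) = f n
    simp [mul_div_cancel₀, this]
  map_add' x y := ext fun n => by
    change ((k n : ℝ) : ℂ) * star (x n + y n) = (k n : ℝ) * star (x n) + (k n : ℝ) * star (y n)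
    rw [star_add, mul_add]
  map_smul' c y := ext fun n => by
    change ((k n : ℝ) : ℂ) * star (c * y n) = star c * ((k n : ℝ) * star (y n))
    rw [star_mul']
    ring
  norm_map' y := by
    refine (sq_eq_sq₀ (norm_nonneg _) (norm_nonneg _)).1 ?_
    refine (norm_sq_eq _).trans <| .trans (tsum_congr fun n => ?_) (norm_sq_eq y).symm
    have := (k n).2.ne'
    change ‖((k n : ℝ) : ℂ) * star (y n)‖ ^ 2 * _ = _
    simp only [norm_mul, norm_star, Complex.norm_real, Real.norm_of_nonneg (k n).2.le,
      Positive.coe_inv]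
    field_simp

theorem riesz_apply (y : WeightedSeries k ℂ) (n : ℕ) :
    riesz y n = (k n : ℝ) * star (y n) := rfl

/-- The pairing `f ↦ ∑ fₙ uₙ` of `ℛ_k` with an element `u` of `ℋ_k`. -/
noncomputable def pairing (u : WeightedSeries k ℂ) : RSpace k →L[ℂ] ℂ :=
  (innerSLFlip ℂ u).comp
    ((riesz (k := k)).symm.toContinuousLinearEquiv : RSpace k →L⋆[ℂ] WeightedSeries k ℂ)

theorem pairing_riesz (u y : WeightedSeries k ℂ) : pairing u (riesz y) = inner ℂ y u :=
  congrArg (inner ℂ · u) (riesz.symm_apply_apply y)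

theorem pairing_smul (c : ℂ) (u : WeightedSeries k ℂ) (f : RSpace k) :
    pairing (c • u) f = c * pairing u f :=
  inner_smul_right (riesz.symm f) u c

theorem hasSum_pairing (u : WeightedSeries k ℂ) (f : RSpace k) :
    HasSum (fun n => f n * u n) (pairing u f) := by
  obtain ⟨y, rfl⟩ := riesz.surjective f
  rw [pairing_riesz]
  refine (hasSum_inner y u).congr_fun fun n => ?_
  simp only [riesz_apply, RCLike.star_def, RCLike.inner_apply]
  ring

/-- The power series whose coefficients form an element of `ℛ_k`. This is the ring `ℛ_k`. -/
def algebra (hk : IsBanachAlgebra k) : Subalgebra ℂ (PowerSeries ℂ) where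
  carrier :=
    {φ | Summable fun n => ‖PowerSeries.coeff n φ‖ ^ 2 * (((k n)⁻¹ : {x : ℝ // 0 < x}) : ℝ)}
  add_mem' {φ ψ} hφ hψ := (weightedSubmodule (fun n => (k n)⁻¹) ℂ).add_mem hφ hψ
  mul_mem' {φ ψ} hφ hψ := by
    obtain ⟨C, hC⟩ := hk
    obtain ⟨h, hh, -⟩ := hC (mk _ hφ) (mk _ hψ)
    exact h.summable.congr fun n => by rw [hh, PowerSeries.coeff_mul]; rfl
  algebraMap_mem' c := summable_of_ne_finset_zero (s := {0}) fun n hn => by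
    simp [PowerSeries.coeff_C, Finset.notMem_singleton.1 hn]

variable {hk : IsBanachAlgebra k}

/-- The element of `ℛ_k` with the coefficients of a given formal power series. -/
noncomputable def toSeries : algebra hk ≃ₗ[ℂ] RSpace k where
  toFun φ := mk (PowerSeries.coeff · φ.1) φ.2
  invFun f := ⟨PowerSeries.mk f, f.summable.congr fun n => by rw [PowerSeries.coeff_mk]⟩
  left_inv φ :=
    Subtype.ext <| PowerSeries.ext fun n => PowerSeries.coeff_mk n (PowerSeries.coeff · φ.1)
  right_inv f := ext fun n => PowerSeries.coeff_mk n f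
  map_add' φ ψ := ext fun n => map_add _ φ.1 ψ.1
  map_smul' c φ := ext fun n => map_smul _ c φ.1

theorem toSeries_apply (φ : algebra hk) (n : ℕ) : toSeries φ n = PowerSeries.coeff n φ.1 := rfl

variable (hk) in
theorem exists_norm_toSeries_mul_le : ∃ C : ℝ, ∀ φ ψ : algebra hk,
    ‖toSeries (φ * ψ)‖ ≤ C * ‖toSeries φ‖ * ‖toSeries ψ‖ := by
  have ⟨C, hC⟩ := hk
  refine ⟨C, fun φ ψ => ?_⟩
  obtain ⟨h, hh, hle⟩ := hC (toSeries φ) (toSeries ψ)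
  have : toSeries (φ * ψ) = h := ext fun n => (PowerSeries.coeff_mul n φ.1 ψ.1).trans (hh n).symm
  rwa [this]

/-- Multiplication by `ψ` as a bounded operator on `ℛ_k`. -/
noncomputable def mulRight (ψ : algebra hk) : RSpace k →L[ℂ] RSpace k :=
  LinearMap.mkContinuousOfExistsBound
    (toSeries.toLinearMap ∘ₗ LinearMap.mulRight ℂ ψ ∘ₗ toSeries.symm.toLinearMap) <| by
    obtain ⟨C, hC⟩ := exists_norm_toSeries_mul_le hk
    refine ⟨C * ‖toSeries ψ‖, fun f => ?_⟩
    simpa [mul_right_comm] using hC (toSeries.symm f) ψ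

theorem mulRight_toSeries (φ ψ : algebra hk) :
    mulRight ψ (toSeries φ) = toSeries (φ * ψ) :=
  congrArg (fun φ => toSeries (φ * ψ)) (toSeries.symm_apply_apply φ)

theorem mulRight_single_apply (ψ : algebra hk) (n : ℕ) (c : ℂ) (m : ℕ) :
    mulRight ψ (single n c) m = if n ≤ m then c * toSeries ψ (m - n) else 0 := by
  have h : ((toSeries.symm (single n c) : algebra hk) : PowerSeries ℂ) =
      PowerSeries.C c * PowerSeries.X ^ n := by
    ext m
    rw [PowerSeries.coeff_C_mul_X_pow]
    exact (PowerSeries.coeff_mk m _).trans (Pi.single_apply n c m)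
  change PowerSeries.coeff m ((toSeries.symm (single n c) : algebra hk).1 * ψ.1) = _
  rw [h, mul_assoc, PowerSeries.coeff_C_mul, PowerSeries.coeff_X_pow_mul', mul_ite, mul_zero,
    toSeries_apply]

theorem pairing_mulRight_single (u : WeightedSeries k ℂ) (ψ : algebra hk) (n : ℕ) (c : ℂ) :
    pairing u (mulRight ψ (single n c)) =
      c * pairing ((backwardShift k ℂ hk.exists_bound ^ n) u) (toSeries ψ) := by
  have h := (hasSum_pairing ((backwardShift k ℂ hk.exists_bound ^ n) u) (toSeries ψ)).mul_left c
  refine (hasSum_pairing u (mulRight ψ (single n c))).unique ?_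
  refine ((add_left_injective n).hasSum_iff fun m hm => ?_).1 (h.congr_fun fun m => ?_)
  · rw [mulRight_single_apply, if_neg fun hnm => hm ⟨m - n, Nat.sub_add_cancel hnm⟩, zero_mul]
  · simp only [Function.comp_apply, mulRight_single_apply, backwardShift_pow_apply,
      Nat.le_add_left, if_true, Nat.add_sub_cancel, mul_assoc]

theorem hasSum_pairing_mul (u : WeightedSeries k ℂ) (φ ψ : algebra hk) :
    HasSum (fun n => toSeries φ n *
        pairing ((backwardShift k ℂ hk.exists_bound ^ n) u) (toSeries ψ))
      (pairing u (toSeries (φ * ψ))) := by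
  rw [← mulRight_toSeries]
  refine ((hasSum_single (toSeries φ)).mapL ((pairing u).comp (mulRight ψ))).congr_fun fun n => ?_
  exact (pairing_mulRight_single u ψ n _).symm

variable {E : Type*} [NormedAddCommGroup E] [InnerProductSpace ℂ E]

theorem norm_pairing_le (u : WeightedSeries k ℂ) (f : RSpace k) :
    ‖pairing u f‖ ≤ ‖u‖ * ‖f‖ := by
  obtain ⟨y, rfl⟩ := riesz.surjective f
  rw [pairing_riesz, riesz.norm_map, mul_comm]
  exact norm_inner_le_norm y u

theorem sum_norm_mul_norm_inner_backwardShift_pow_le (f : RSpace k) (x y : WeightedSeries k E)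
    (s : Finset ℕ) :
    ∑ n ∈ s, ‖f n‖ * ‖inner ℂ y ((backwardShift k E hk.exists_bound ^ n) x)‖ ≤
      ‖x‖ * ‖toSeries ((toSeries.symm f.abs : algebra hk) * toSeries.symm (riesz y.abs))‖ := by
  set φ : algebra hk := toSeries.symm f.abs
  set ψ : algebra hk := toSeries.symm (riesz y.abs)
  have hre := Complex.hasSum_re (hasSum_pairing_mul x.abs φ ψ)
  have hterm (n : ℕ) : (toSeries φ n *
      pairing ((backwardShift k ℂ hk.exists_bound ^ n) x.abs) (toSeries ψ)).re =
      ‖f n‖ * (inner ℂ y.abs ((backwardShift k E hk.exists_bound ^ n) x).abs).re := by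
    rw [toSeries.apply_symm_apply, toSeries.apply_symm_apply, pairing_riesz,
      ← abs_backwardShift_pow, abs_apply, Complex.re_ofReal_mul]
  simp only [hterm] at hre
  calc ∑ n ∈ s, ‖f n‖ * ‖inner ℂ y ((backwardShift k E hk.exists_bound ^ n) x)‖
      ≤ ∑ n ∈ s, ‖f n‖ *
          (inner ℂ y.abs ((backwardShift k E hk.exists_bound ^ n) x).abs).re :=
        Finset.sum_le_sum fun n _ =>
          mul_le_mul_of_nonneg_left (norm_inner_le_re_inner_abs _ _) (norm_nonneg _)
    _ ≤ (pairing x.abs (toSeries (φ * ψ))).re :=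
        sum_le_hasSum s (fun n _ => mul_nonneg (norm_nonneg _)
          ((norm_nonneg _).trans (norm_inner_le_re_inner_abs _ _))) hre
    _ ≤ ‖x‖ * ‖toSeries (φ * ψ)‖ :=
        (Complex.re_le_norm _).trans ((norm_pairing_le _ _).trans_eq (by rw [norm_abs]))

variable (hk E) in
theorem exists_norm_sum_smul_backwardShift_pow_le : ∃ C : ℝ, ∀ (f : RSpace k) (s : Finset ℕ),
    ‖∑ n ∈ s, f n • backwardShift k E hk.exists_bound ^ n‖ ≤ C * ‖f‖ := by
  obtain ⟨C, hC⟩ := exists_norm_toSeries_mul_le hk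
  refine ⟨|C|, fun f s =>
    ContinuousLinearMap.opNorm_le_of_re_inner_le (by positivity) fun x y hx hy => ?_⟩
  set φ : algebra hk := toSeries.symm f.abs
  set ψ : algebra hk := toSeries.symm (riesz y.abs)
  have hφ : ‖toSeries φ‖ = ‖f‖ := by rw [toSeries.apply_symm_apply, norm_abs]
  have hψ : ‖toSeries ψ‖ = 1 := by
    rw [toSeries.apply_symm_apply, riesz.norm_map, norm_abs, hy]
  calc RCLike.re (inner ℂ ((∑ n ∈ s, f n • backwardShift k E hk.exists_bound ^ n) x) y)
      ≤ ‖∑ n ∈ s, f n * inner ℂ y ((backwardShift k E hk.exists_bound ^ n) x)‖ := by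
        rw [inner_re_symm]
        refine (RCLike.re_le_norm _).trans_eq ?_
        simp only [_root_.sum_apply, smul_apply, inner_sum, inner_smul_right]
    _ ≤ ‖x‖ * ‖toSeries (φ * ψ)‖ := by
        refine (norm_sum_le _ _).trans ?_
        simpa only [norm_mul] using sum_norm_mul_norm_inner_backwardShift_pow_le f x y s
    _ ≤ |C| * ‖f‖ := by
        rw [hx, one_mul]
        refine (hC φ ψ).trans ?_
        rw [hφ, hψ, mul_one]
        exact mul_le_mul_of_nonneg_right (le_abs_self C) (norm_nonneg f)

end RSpace

namespace WeightedSeries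

theorem summable_smul_of_norm_sum_le {w : PosWeight} {F : Type*} [NormedAddCommGroup F]
    [NormedSpace ℂ F] [CompleteSpace F] {a : ℕ → F} {C : ℝ}
    (h : ∀ (f : WeightedSeries w ℂ) (s : Finset ℕ), ‖∑ n ∈ s, f n • a n‖ ≤ C * ‖f‖)
    (f : WeightedSeries w ℂ) : Summable fun n => f n • a n := by
  refine summable_iff_vanishing_norm.2 fun ε hε => ?_
  have hC : 0 < |C| + 1 := by positivity
  obtain ⟨s, hs⟩ := cauchySeq_finset_iff_vanishing_norm.1
    (hasSum_single f).summable.hasSum.cauchySeq (ε / (|C| + 1)) (div_pos hε hC)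
  refine ⟨s, fun t hts => ?_⟩
  set g : WeightedSeries w ℂ := ∑ n ∈ t, single n (f n)
  calc ‖∑ n ∈ t, f n • a n‖ = ‖∑ n ∈ t, g n • a n‖ := by
        refine congrArg _ (Finset.sum_congr rfl fun n hn => ?_)
        rw [sum_single_apply, if_pos hn]
    _ ≤ C * ‖g‖ := h g t
    _ ≤ (|C| + 1) * ‖g‖ :=
        mul_le_mul_of_nonneg_right ((le_abs_self C).trans (lt_add_one _).le) (norm_nonneg g)
    _ < ε := (lt_div_iff₀' hC).1 (hs t hts)

end WeightedSeries

section Semiconj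

variable {𝕜 H K : Type*} [NontriviallyNormedField 𝕜] [NormedAddCommGroup H] [NormedSpace 𝕜 H]
  [NormedAddCommGroup K] [NormedSpace 𝕜 K] {T : H →L[𝕜] H} {A : K →L[𝕜] K} {J : H →L[𝕜] K}

theorem map_pow_of_semiconj (hJ : Function.Semiconj J T A) (n : ℕ) (x : H) :
    J ((T ^ n) x) = (A ^ n) (J x) := by
  simpa only [pow_apply_eq_iterate] using hJ.iterate_right n x

theorem norm_sum_smul_pow_le_of_semiconj {c : NNReal} (hc : AntilipschitzWith c J)
    (hJ : Function.Semiconj J T A) (f : ℕ → 𝕜) (s : Finset ℕ) :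
    ‖∑ n ∈ s, f n • T ^ n‖ ≤ c * ‖J‖ * ‖∑ n ∈ s, f n • A ^ n‖ := by
  refine ContinuousLinearMap.opNorm_le_bound _ (by positivity) fun x => ?_
  have hsum : J ((∑ n ∈ s, f n • T ^ n) x) = (∑ n ∈ s, f n • A ^ n) (J x) := by
    simp only [sum_apply, smul_apply, map_sum, map_smul, map_pow_of_semiconj hJ]
  calc ‖(∑ n ∈ s, f n • T ^ n) x‖
      ≤ c * ‖J ((∑ n ∈ s, f n • T ^ n) x)‖ := hc.le_mul_norm (map_zero J) _
    _ ≤ c * (‖∑ n ∈ s, f n • A ^ n‖ * (‖J‖ * ‖x‖)) := by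
        rw [hsum]
        gcongr
        exact (ContinuousLinearMap.le_opNorm _ _).trans (by gcongr; exact J.le_opNorm x)
    _ = c * ‖J‖ * ‖∑ n ∈ s, f n • A ^ n‖ * ‖x‖ := by ring

end Semiconj

theorem hasSum_smul_pow_zero_of_semiconj {𝕜 H K : Type*} [RCLike 𝕜] [NormedAddCommGroup H]
    [NormedSpace 𝕜 H] [NormedAddCommGroup K] [InnerProductSpace 𝕜 K] {T : H →L[𝕜] H}
    {A : K →L[𝕜] K} {J : H →L[𝕜] K} (hinj : Function.Injective J)
    (hJ : Function.Semiconj J T A) {f : ℕ → 𝕜} (hf : Summable fun n => f n • T ^ n)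
    (h : ∀ x y, HasSum (fun n => f n * inner 𝕜 y ((A ^ n) (J x))) 0) :
    HasSum (fun n => f n • T ^ n) 0 := by
  suffices hzero : ∑' n, f n • T ^ n = 0 from hzero ▸ hf.hasSum
  ext x
  refine hinj (ext_inner_left 𝕜 fun y => ?_)
  have hsum : HasSum (fun n => f n * inner 𝕜 y ((A ^ n) (J x)))
      (inner 𝕜 y (J ((∑' n, f n • T ^ n) x))) := by
    refine (hf.hasSum.mapL (((innerSL 𝕜 y).comp J).comp (.apply 𝕜 H x))).congr_fun fun n => ?_
    rw [← map_pow_of_semiconj hJ]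
    simp
  simpa using hsum.unique (h x y)

theorem IsSimilarToPart.exists_antilipschitz_semiconj {H K : Type*} [NormedAddCommGroup H]
    [InnerProductSpace ℂ H] [NormedAddCommGroup K] [InnerProductSpace ℂ K] {T : H →L[ℂ] H}
    {A : K →L[ℂ] K} (hT : IsSimilarToPart T A) :
    ∃ (J : H →L[ℂ] K) (c : NNReal), AntilipschitzWith c J ∧ Function.Semiconj J T A := by
  obtain ⟨L, -, -, S, hS⟩ := hT
  exact ⟨L.subtypeL.comp (S : H →L[ℂ] L), _, S.antilipschitz, hS⟩

theorem IsSimilarToPart.summable_smul_pow {k : PosWeight} (hk : RSpace.IsBanachAlgebra k)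
    {E : Type*} [NormedAddCommGroup E] [InnerProductSpace ℂ E]
    {H : Type*} [NormedAddCommGroup H] [InnerProductSpace ℂ H] [CompleteSpace H]
    {T : H →L[ℂ] H} (hT : IsSimilarToPart T (backwardShift k E hk.exists_bound)) (f : RSpace k) :
    Summable fun n => f n • T ^ n := by
  obtain ⟨J, c, hc, hJ⟩ := hT.exists_antilipschitz_semiconj
  obtain ⟨C, hC⟩ := RSpace.exists_norm_sum_smul_backwardShift_pow_le hk E
  refine WeightedSeries.summable_smul_of_norm_sum_le (C := c * ‖J‖ * C) (fun f s => ?_) f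
  refine (norm_sum_smul_pow_le_of_semiconj hc hJ f s).trans ?_
  rw [mul_assoc _ C]
  exact mul_le_mul_of_nonneg_left (hC f s) (by positivity)

theorem hasSum_smul_pow_zero_of_mem_spectrum {𝕜 A : Type*} [NormedField 𝕜] [NormedRing A]
    [NormedAlgebra 𝕜 A] [CompleteSpace A] {a : A} {f : ℕ → 𝕜}
    (h : HasSum (fun n => f n • a ^ n) 0) {z : 𝕜} (hz : z ∈ spectrum 𝕜 a) :
    HasSum (fun n => f n * z ^ n) 0 := by
  have hmem (s : Finset ℕ) : ∑ n ∈ s, f n * z ^ n ∈ spectrum 𝕜 (∑ n ∈ s, f n • a ^ n) := by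
    have := spectrum.subset_polynomial_aeval a (∑ n ∈ s, Polynomial.monomial n (f n))
      (Set.mem_image_of_mem _ hz)
    simpa [Polynomial.eval_finsetSum, Algebra.smul_def, Polynomial.aeval_monomial] using this
  have hbound : Tendsto (fun s : Finset ℕ => ‖∑ n ∈ s, f n • a ^ n‖ * ‖(1 : A)‖) atTop (𝓝 0) := by
    simpa using (tendsto_norm.comp h).mul_const ‖(1 : A)‖
  exact squeeze_zero_norm (fun s => spectrum.norm_le_norm_mul_of_mem (hmem s)) hbound

theorem eq_zero_of_apply_eq_smul_of_notMem_spectrum {𝕜 F : Type*} [NontriviallyNormedField 𝕜]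
    [NormedAddCommGroup F] [NormedSpace 𝕜 F] {T : F →L[𝕜] F} {z : 𝕜} (hz : z ∉ spectrum 𝕜 T)
    {x : F} (hx : T x = z • x) : x = 0 := by
  obtain ⟨S, hS⟩ := (spectrum.notMem_iff.1 hz).exists_left_inv
  have h := congrArg (fun A : F →L[𝕜] F => A x) hS
  simpa [Algebra.algebraMap_eq_smul_one, hx] using h.symm

theorem det_smul_mem_of_row_mem {ι A : Type*} [Fintype ι] [DecidableEq ι] [CommRing A]
    {N : Submodule A (ι → A)} {M : Matrix ι ι A} (hM : ∀ i, M i ∈ N) (v : ι → A) :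
    M.det • v ∈ N := by
  have hv : M.det • v = Matrix.vecMul (Matrix.vecMul v M.adjugate) M := by
    rw [Matrix.vecMul_vecMul, Matrix.adjugate_mul, Matrix.vecMul_smul, Matrix.vecMul_one]
  rw [hv, Matrix.vecMul_eq_sum]
  exact N.sum_mem fun i _ => N.smul_mem _ (hM i)

namespace RSpace

open WeightedSeries

variable {k : PosWeight} {hk : IsBanachAlgebra k}
  {E : Type*} [NormedAddCommGroup E] [InnerProductSpace ℂ E] {z : ℂ}

/-- The eigenvector `∑ zⁿ e tⁿ` of the backward shift for the eigenvalue `z`, as a function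
of `e`. -/
def eigenvector (hz : Summable fun n => (k n : ℝ) * ‖z‖ ^ (2 * n)) :
    E →ₗ[ℂ] WeightedSeries k E where
  toFun e := mk (fun n => z ^ n • e) <| (hz.mul_left (‖e‖ ^ 2)).congr fun n => by
    rw [norm_smul, norm_pow]
    ring
  map_add' e e' := ext fun n => smul_add (z ^ n) e e'
  map_smul' c e := ext fun n => smul_comm (z ^ n) c e

variable (hz : Summable fun n => (k n : ℝ) * ‖z‖ ^ (2 * n))

theorem eigenvector_apply (e : E) (n : ℕ) : eigenvector hz e n = z ^ n • e := rfl

theorem eigenvector_injective : Function.Injective (eigenvector (E := E) hz) := fun e e' h => by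
  have h0 := congrArg (fun x : WeightedSeries k E => x 0) h
  simpa only [eigenvector_apply, pow_zero, one_smul] using h0

theorem backwardShift_pow_eigenvector {hw : ∃ C : ℝ, ∀ n, (k n : ℝ) ≤ C * (k (n + 1) : ℝ)}
    (n : ℕ) (e : E) :
    (backwardShift k E hw ^ n) (eigenvector hz e) = z ^ n • eigenvector hz e :=
  ext fun m => by
    rw [backwardShift_pow_apply, eigenvector_apply, add_comm, pow_add, mul_smul]
    rfl

/-- Evaluation at `z`, as a character of the ring `ℛ_k`. -/
noncomputable def eval : algebra hk →+* ℂ where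
  toFun φ := pairing (eigenvector hz 1) (toSeries φ)
  map_zero' := by simp
  map_add' φ ψ := by simp
  map_one' := by
    refine (hasSum_pairing _ _).unique ?_
    convert! hasSum_ite_eq 0 (1 : ℂ) using 2 with n
    change PowerSeries.coeff n 1 * (z ^ n • (1 : ℂ)) = _
    by_cases hn : n = 0 <;> simp [PowerSeries.coeff_one, hn]
  map_mul' φ ψ := by
    have hψ (n : ℕ) : toSeries φ n * pairing ((backwardShift k ℂ hk.exists_bound ^ n)
        (eigenvector hz 1)) (toSeries ψ) =
        toSeries φ n * eigenvector hz 1 n * pairing (eigenvector hz 1) (toSeries ψ) := by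
      rw [backwardShift_pow_eigenvector, pairing_smul, eigenvector_apply, smul_eq_mul, mul_one,
        mul_assoc]
    refine (hasSum_pairing_mul _ φ ψ).unique ?_
    simp only [hψ]
    exact (hasSum_pairing _ _).mul_right _

theorem eval_apply (φ : algebra hk) :
    eval hz φ = pairing (eigenvector hz 1) (toSeries φ) := rfl

variable {ι : Type*} [Fintype ι] (b : OrthonormalBasis ι ℂ E)

/-- The pairing of a row of elements of `ℛ_k` with an element of `ℋ_k ⊗ E`, in the coordinates of
the orthonormal basis `b` of `E`. -/
noncomputable def rowPairing (x : WeightedSeries k E) : (ι → algebra hk) →ₗ[ℂ] ℂ :=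
  ∑ i, (pairing (coord (b i) x)).toLinearMap ∘ₗ toSeries.toLinearMap ∘ₗ LinearMap.proj i

theorem rowPairing_apply (x : WeightedSeries k E) (Ψ : ι → algebra hk) :
    rowPairing b x Ψ = ∑ i, pairing (coord (b i) x) (toSeries (Ψ i)) := by
  simp [rowPairing]

theorem hasSum_rowPairing_smul (x : WeightedSeries k E) (φ : algebra hk) (Ψ : ι → algebra hk) :
    HasSum (fun n => toSeries φ n * rowPairing b ((backwardShift k E hk.exists_bound ^ n) x) Ψ)
      (rowPairing b x (φ • Ψ)) := by
  simp only [rowPairing_apply, Finset.mul_sum, coord_backwardShift_pow]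
  exact hasSum_sum fun i _ => hasSum_pairing_mul (coord (b i) x) φ (Ψ i)

/-- The row of elements of `ℛ_k` that represents the functional `⟨y, ·⟩`. -/
noncomputable def row (hk : IsBanachAlgebra k) (y : WeightedSeries k E) : ι → algebra hk :=
  fun i => toSeries.symm (riesz (coord (b i) y))

theorem rowPairing_row (x y : WeightedSeries k E) :
    rowPairing b x (row b hk y) = inner ℂ y x := by
  simp only [rowPairing_apply, row, toSeries.apply_symm_apply, pairing_riesz, sum_inner_coord]

theorem eval_row (y : WeightedSeries k E) (i : ι) :
    eval hz (row b hk y i) = inner ℂ y (eigenvector hz (b i)) := by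
  rw [eval_apply, row, toSeries.apply_symm_apply, pairing_riesz]
  refine (hasSum_inner _ _).unique ((hasSum_inner _ _).congr_fun fun n => ?_)
  simp [eigenvector_apply, coord_apply]

/-- The rows of elements of `ℛ_k` that annihilate an invariant subspace `L`. They form a module over
the ring `ℛ_k`. -/
def rowAnnihilator (L : Submodule ℂ (WeightedSeries k E))
    (hL : Set.MapsTo (backwardShift k E hk.exists_bound) L L) :
    Submodule (algebra hk) (ι → algebra hk) where
  carrier := {Ψ | ∀ x ∈ L, rowPairing b x Ψ = 0}
  zero_mem' x _ := map_zero (rowPairing b x)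
  add_mem' hΨ hΦ x hx := by rw [map_add, hΨ x hx, hΦ x hx, add_zero]
  smul_mem' φ Ψ hΨ x hx := by
    refine (hasSum_rowPairing_smul b x φ Ψ).unique (hasSum_zero.congr_fun fun n => ?_)
    have hn : (backwardShift k E hk.exists_bound ^ n) x ∈ L := by
      simpa only [pow_apply_eq_iterate, SetLike.mem_coe] using hL.iterate n hx
    rw [hΨ _ hn, mul_zero]

theorem row_mem_rowAnnihilator {L : Submodule ℂ (WeightedSeries k E)}
    (hL : Set.MapsTo (backwardShift k E hk.exists_bound) L L) {y : WeightedSeries k E}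
    (hy : y ∈ Lᗮ) : row b hk y ∈ rowAnnihilator b L hL := fun x hx =>
  (rowPairing_row b x y).trans (L.inner_left_of_mem_orthogonal hx hy)

variable {L : Submodule ℂ (WeightedSeries k E)}

theorem linearIndependent_starProjection_eigenvector [L.HasOrthogonalProjection]
    {hw : ∃ C : ℝ, ∀ n, (k n : ℝ) ≤ C * (k (n + 1) : ℝ)}
    (hzL : ∀ x ∈ L, backwardShift k E hw x = z • x → x = 0)
    {κ : Type*} {e : κ → E} (he : LinearIndependent ℂ e) :
    LinearIndependent ℂ fun i => Lᗮ.starProjection (eigenvector hz (e i)) := by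
  refine he.map' (Lᗮ.starProjection.toLinearMap ∘ₗ eigenvector hz) ?_
  refine LinearMap.ker_eq_bot'.2 fun x hx => eigenvector_injective hz ?_
  have hmem : eigenvector hz x ∈ L := by
    refine L.starProjection_eq_self_iff.1 (sub_eq_zero.1 ?_).symm
    exact (L.starProjection_orthogonal_val _).symm.trans hx
  rw [map_zero]
  exact hzL _ hmem (by simpa using backwardShift_pow_eigenvector hz 1 x)

theorem eval_det_row_starProjection [DecidableEq ι]
    (P : Submodule ℂ (WeightedSeries k E)) [P.HasOrthogonalProjection] :
    eval hz (Matrix.of fun i => row b hk (P.starProjection (eigenvector hz (b i)))).det =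
      (Matrix.gram ℂ fun i => P.starProjection (eigenvector hz (b i))).det := by
  rw [RingHom.map_det]
  congr 1
  ext i j
  refine (eval_row hz b _ j).trans ?_
  rw [Matrix.gram_apply, ← Submodule.inner_starProjection_left_eq_right,
    P.starProjection_eq_self_iff.2 (P.starProjection_apply_mem _)]

variable (hk) in
theorem exists_annihilator [FiniteDimensional ℂ E]
    (hLc : IsComplete (L : Set (WeightedSeries k E)))
    (hL : Set.MapsTo (backwardShift k E hk.exists_bound) L L)
    (hz : Summable fun n => (k n : ℝ) * ‖z‖ ^ (2 * n))
    (hzL : ∀ x ∈ L, backwardShift k E hk.exists_bound x = z • x → x = 0) :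
    ∃ f : RSpace k, f ≠ 0 ∧ ∀ x ∈ L, ∀ y,
      HasSum (fun n => f n * inner ℂ y ((backwardShift k E hk.exists_bound ^ n) x)) 0 := by
  have : CompleteSpace L := hLc.completeSpace_coe
  let b := stdOrthonormalBasis ℂ E
  let M : Matrix _ _ (algebra hk) :=
    .of fun i => row b hk (Lᗮ.starProjection (eigenvector hz (b i)))
  have hdet (y : WeightedSeries k E) : M.det • row b hk y ∈ rowAnnihilator b L hL :=
    det_smul_mem_of_row_mem
      (fun i => row_mem_rowAnnihilator b hL (Submodule.starProjection_apply_mem _ _)) _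
  have hne : eval hz M.det ≠ 0 := by
    rw [eval_det_row_starProjection]
    exact Matrix.det_gram_ne_zero_iff_linearIndependent.2
      (linearIndependent_starProjection_eigenvector hz hzL b.toBasis.linearIndependent)
  refine ⟨toSeries M.det, fun h => hne ?_, fun x hx y => ?_⟩
  · rw [toSeries.map_eq_zero_iff.1 h, map_zero]
  · simpa only [rowPairing_row, hdet y x hx] using hasSum_rowPairing_smul b x M.det (row b hk y)

end RSpace

theorem IsReciprocalPair.summable_mul_norm_pow {α : ℕ → ℝ} {k : PosWeight}
    (hk : IsReciprocalPair α k) {z : ℂ} (hz : ‖z‖ < 1) :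
    Summable fun n => (k n : ℝ) * ‖z‖ ^ (2 * n) := by
  have hsum := (hk.hasSum_k ((‖z‖ ^ 2 : ℝ) : ℂ) (by simpa using hz)).summable
  norm_cast at hsum
  simpa only [pow_mul] using hsum

theorem theorem5p1_general (k : PosWeight) (halg : RSpace.IsBanachAlgebra k)
    {D : Type*} [NormedAddCommGroup D] [InnerProductSpace ℂ D] [FiniteDimensional ℂ D]
    {H : Type*} [NormedAddCommGroup H] [InnerProductSpace ℂ H] [CompleteSpace H]
    (T : H →L[ℂ] H) (hT : IsSimilarToPart T (backwardShift k D halg.exists_bound))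
    {z : ℂ} (hzσ : z ∉ spectrum ℂ T) (hz : Summable fun n => (k n : ℝ) * ‖z‖ ^ (2 * n)) :
    ∃ f : RSpace k, f ≠ 0 ∧ ∀ w ∈ spectrum ℂ T, HasSum (fun n => f n * w ^ n) 0 := by
  obtain ⟨J, c, hc, hJ⟩ := hT.exists_antilipschitz_semiconj
  obtain ⟨f, hf, hann⟩ := RSpace.exists_annihilator halg (L := J.range)
    (hc.isComplete_range J.uniformContinuous)
    (by rintro _ ⟨x, rfl⟩; exact ⟨T x, hJ x⟩) hz <| by
      rintro _ ⟨x, rfl⟩ hx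
      have hTx : T x = z • x := hc.injective <| by rw [← map_smul] at hx; exact (hJ x).trans hx
      rw [eq_zero_of_apply_eq_smul_of_notMem_spectrum hzσ hTx]
      exact map_zero J
  have hfT : HasSum (fun n => f n • T ^ n) 0 :=
    hasSum_smul_pow_zero_of_semiconj hc.injective hJ (hT.summable_smul_pow halg f)
      fun x y => hann _ ⟨x, rfl⟩ y
  exact ⟨f, hf, fun w hw => hasSum_smul_pow_zero_of_mem_spectrum hfT hw⟩

theorem theorem5p1 (α : ℕ → ℝ) (k : PosWeight) (hk : IsReciprocalPair α k)
    (halg : RSpace.IsBanachAlgebra k)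
    (hr : Tendsto (fun n : ℕ => (⨅ j : ℕ, (k j : ℝ) / (k (n + j) : ℝ)) ^ (1 / (n : ℝ)))
      atTop (𝓝 1))
    (hroot : Tendsto (fun n : ℕ => (k n : ℝ) ^ (1 / (n : ℝ))) atTop (𝓝 1))
    {D : Type*} [NormedAddCommGroup D] [InnerProductSpace ℂ D] [FiniteDimensional ℂ D]
    {H : Type*} [NormedAddCommGroup H] [InnerProductSpace ℂ H] [CompleteSpace H]
    (T : H →L[ℂ] H)
    (hT : IsSimilarToPart T (backwardShift k D halg.exists_bound))
    (hσ : ¬ Metric.ball (0 : ℂ) 1 ⊆ spectrum ℂ T) :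
    ∃ f : RSpace k, f ≠ 0 ∧ spectrum ℂ T ∩ Metric.ball (0 : ℂ) 1 ⊆ RSpace.zeroSet f := by
  obtain ⟨z, hz1, hzσ⟩ := Set.not_subset.1 hσ
  obtain ⟨f, hf, hzero⟩ := theorem5p1_general k halg T hT hzσ
    (hk.summable_mul_norm_pow (mem_ball_zero_iff.1 hz1))
  exact ⟨f, hf, fun w hw => ⟨mem_ball_zero_iff.1 hw.2, hzero w hw.1⟩⟩
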